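/- Let $X$ be a compact metric space, let $c\colon X\times X\to[0,\infty)$ be symmetric and Lipschitz continuous, and let $\mu,\nu$ be Borel probability measures on $X$. Let $\Pi(\mu,\nu)$ be the set of probability measures on $X\times X$ with marginals $\mu$ and $\nu$, and put $$\mathrm{OT}(\mu,\nu)=\inf_{\pi\in\Pi(\mu,\nu)}\int c\,d\pi,\qquad \mathrm{OT}_\varepsilon(\mu,\nu)=\inf_{\pi\in\Pi(\mu,\nu)}\Big\{\int c\,d\pi+\varepsilon\,\mathrm{KL}(\pi,\mu\otimes\nu)\Big\}\ (\varepsilon>0),\qquad \mathrm{OT}_\infty(\mu,\nu)=\int c\,d(\mu\otimes\nu),$$ where $\mathrm{KL}$ is the Kullback--Leibler divergence. For $\varepsilon>0$, a pair of optimal entropic dual potentials is a maximizer $(\hat\varphi_\varepsilon,\hat\psi_\varepsilon)\in C(X)^2$ of $$(\varphi,\psi)\mapsto\int\varphi\,d\mu+\int\psi\,d\nu-\varepsilon\int\Big(\exp\Big(\frac{\varphi(x)+\psi(y)-c(x,y)}{\varepsilon}\Big)-1\Big)\,d(\mu\otimes\nu)(x,y).$$ An optimal dual pair for $\mathrm{OT}(\mu,\nu)$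 is a maximizer of $\int\varphi\,d\mu+\int\psi\,d\nu$ over all $(\varphi,\psi)\in C(X)^2$ with $\varphi(x)+\psi(y)\le c(x,y)$ for all $x,y\in X$. For every $\varepsilon>0$ there are optimal entropic dual potentials satisfying the normalization $$\int\varphi\,d\mu=\tfrac12\mathrm{OT}_\infty(\mu,\nu),\qquad(*)$$ and under $(*)$ the restrictions $\hat\varphi_\varepsilon|_{\operatorname{supp}\mu}$ and $\hat\psi_\varepsilon|_{\operatorname{supp}\nu}$ are unique. With $(*)$ imposed on $\hat\varphi_\varepsilon$ for every $\varepsilon>0$, the following hold. (i) As $\varepsilon\to\infty$, $\hat\varphi_\varepsilon|_{\operatorname{supp}\mu}$ and $\hat\psi_\varepsilon|_{\operatorname{supp}\nu}$ converge uniformly to (the restrictions of) $$\hat\varphi_\infty(x)=\int c(x,y)\,d\nu(y)-\tfrac12\mathrm{OT}_\infty(\mu,\nu),\qquad \hat\psi_\infty(y)=\int c(x,y)\,d\mu(x)-\tfrac12\mathrm{OT}_\infty(\mu,\nu),$$ respectively. (ii) As $\varepsilon\to0$, every accumulation point of $(\hat\varphi_\varepsilon|_{\operatorname{supp}\mu},\hat\psi_\varepsilon|_{\operatorname{supp}\nu})$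 in $C(\operatorname{supp}\mu)\times C(\operatorname{supp}\nu)$ (with uniform convergence) can be extended to an optimal dual pair $(\varphi,\psi)\in C(X)^2$ for $\mathrm{OT}(\mu,\nu)$ that satisfies $(*)$, and $\int\varphi\,d\mu+\int\psi\,d\nu=\mathrm{OT}(\mu,\nu)$. Moreover, $\lim_{\varepsilon\to0}\mathrm{OT}_\varepsilon(\mu,\nu)=\mathrm{OT}(\mu,\nu)$. -/

import Mathlib

open MeasureTheory Filter Topology

noncomputable section

namespace EntropicOT

/-- Transport plans `Π(μ, ν)`: measures on `X × X` with marginals `μ` and `ν`.  They are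
automatically probability measures when `μ` and `ν` are. -/
def plans {X : Type*} [MeasurableSpace X] (μ ν : Measure X) : Set (Measure (X × X)) :=
  {π | π.fst = μ ∧ π.snd = ν}

/-- The Kantorovich cost `OT(μ, ν) = inf_{π ∈ Π(μ, ν)} ∫ c dπ`. -/
def OT {X : Type*} [MeasurableSpace X] (c : X → X → ℝ) (μ ν : Measure X) : ℝ :=
  sInf {r : ℝ | ∃ π ∈ plans μ ν, r = ∫ p, c p.1 p.2 ∂π}

/-- The entropic cost `OT_ε(μ, ν) = inf_{π ∈ Π(μ, ν)} (∫ c dπ + ε KL(π, μ ⊗ ν))`.  For `ε > 0`,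
plans of infinite divergence have infinite objective value, so the infimum is taken over
the plans of finite divergence (among which is `μ ⊗ ν`). -/
def OTEps {X : Type*} [MeasurableSpace X] (c : X → X → ℝ) (ε : ℝ) (μ ν : Measure X) : ℝ :=
  sInf {r : ℝ | ∃ π ∈ plans μ ν, InformationTheory.klDiv π (μ.prod ν) ≠ ⊤ ∧
    r = ∫ p, c p.1 p.2 ∂π + ε * (InformationTheory.klDiv π (μ.prod ν)).toReal}

/-- `OT_∞(μ, ν) = ∫ c d(μ ⊗ ν)`. -/
def OTInf {X : Type*} [MeasurableSpace X] (c : X → X → ℝ) (μ ν : Measure X) : ℝ :=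
  ∫ p, c p.1 p.2 ∂(μ.prod ν)

/-- The objective of the dual entropic problem. -/
def entropicDual {X : Type*} [TopologicalSpace X] [MeasurableSpace X] (c : X → X → ℝ) (ε : ℝ)
    (μ ν : Measure X) (φ ψ : C(X, ℝ)) : ℝ :=
  ∫ x, φ x ∂μ + ∫ y, ψ y ∂ν
    - ε * ∫ p, (Real.exp ((φ p.1 + ψ p.2 - c p.1 p.2) / ε) - 1) ∂(μ.prod ν)

/-- `(φ, ψ)` is a pair of optimal entropic dual potentials: it maximizes the dual objective
over `C(X) × C(X)`. -/
def IsEntropicOptimal {X : Type*} [TopologicalSpace X] [MeasurableSpace X] (c : X → X → ℝ)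
    (ε : ℝ) (μ ν : Measure X) (φ ψ : C(X, ℝ)) : Prop :=
  ∀ φ' ψ' : C(X, ℝ), entropicDual c ε μ ν φ' ψ' ≤ entropicDual c ε μ ν φ ψ

/-- The normalization `∫ φ dμ = ½ OT_∞(μ, ν)`. -/
def IsNormalized {X : Type*} [TopologicalSpace X] [MeasurableSpace X] (c : X → X → ℝ)
    (μ ν : Measure X) (φ : C(X, ℝ)) : Prop :=
  ∫ x, φ x ∂μ = 1 / 2 * OTInf c μ ν

/-- Feasibility for the Kantorovich dual problem. -/
def IsFeasible {X : Type*} [TopologicalSpace X] (c : X → X → ℝ) (φ ψ : C(X, ℝ)) : Prop :=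
  ∀ x y, φ x + ψ y ≤ c x y

/-- `(φ, ψ)` is an optimal Kantorovich dual pair: it is feasible, and it maximizes
`∫ φ dμ + ∫ ψ dν` among the feasible pairs. -/
def IsKantorovichOptimal {X : Type*} [TopologicalSpace X] [MeasurableSpace X] (c : X → X → ℝ)
    (μ ν : Measure X) (φ ψ : C(X, ℝ)) : Prop :=
  IsFeasible c φ ψ ∧ ∀ φ' ψ' : C(X, ℝ), IsFeasible c φ' ψ' →
    ∫ x, φ' x ∂μ + ∫ y, ψ' y ∂ν ≤ ∫ x, φ x ∂μ + ∫ y, ψ y ∂ν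

end EntropicOT

end

/-! With one potential fixed, the entropic dual is maximized in the other by its soft `c`-transform,
a log-sum-exp `softMin` of the cost minus the fixed potential. The gap
`entropicDual_softTransform_sub` has a nonnegative integrand, so optimal potentials are soft
transforms of each other on the supports. Soft transforms inherit the Lipschitz constant of the
cost, whatever `ε` is; Arzelà–Ascoli then gives maximizers with bounds uniform in `ε`, and strict
concavity (`entropicDual_midpoint`) gives uniqueness.

For large `ε`, `softMin` differs from the mean by `O(1/ε)`, so the fixed-point equations become
linear and the normalization determines the limit.

For small `ε`, `softMin` becomes a minimum over the support. Uniform limits of potentials are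
therefore `c`-conjugate on the supports and extend to a feasible pair on `X`. The dual value for `ε`
is the entropic cost of the Gibbs plan (`IsEntropicOptimal.exists_plan`), hence at least `OT`, while
weak duality bounds the limit pair by `OT`. This yields strong duality and optimality together;
ultrafilters provide the limits. -/

namespace EntropicOT

/-- The soft minimum `-ε log ∫ exp(-f / ε) dμ`. -/
noncomputable def softMin {X : Type*} [MeasurableSpace X] (ε : ℝ) (μ : Measure X) (f : X → ℝ) : ℝ :=
  -ε * Real.log (∫ x, Real.exp (-f x / ε) ∂μ)

theorem softMin_const {X : Type*} [MeasurableSpace X] {ε : ℝ} (hε : 0 < ε)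
    (μ : Measure X) [IsProbabilityMeasure μ] (a : ℝ) :
    softMin ε μ (fun _ : X => a) = a := by
  simp only [softMin, integral_const, probReal_univ, smul_eq_mul, one_mul, Real.log_exp]
  field_simp

/-! ### Estimates for the soft minimum. -/

section SoftMin

variable {X : Type*} [TopologicalSpace X] [CompactSpace X] [MeasurableSpace X]
  [OpensMeasurableSpace X]

theorem integrable_of_continuous {f : X → ℝ} (hf : Continuous f) (μ : Measure X)
    [IsFiniteMeasure μ] : Integrable f μ :=
  hf.integrable_of_hasCompactSupport (HasCompactSupport.of_compactSpace f)

variable {ε : ℝ} {μ : Measure X} [IsProbabilityMeasure μ] {f g : X → ℝ}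

theorem integral_exp_neg_div_pos (ε : ℝ) (μ : Measure X) [IsProbabilityMeasure μ]
    (hf : Continuous f) : 0 < ∫ x, Real.exp (-f x / ε) ∂μ :=
  integral_exp_pos (integrable_of_continuous (by fun_prop) μ)

theorem exp_neg_softMin_div (hε : 0 < ε) (μ : Measure X) [IsProbabilityMeasure μ]
    (hf : Continuous f) :
    Real.exp (-softMin ε μ f / ε) = ∫ x, Real.exp (-f x / ε) ∂μ := by
  have h : -softMin ε μ f / ε = Real.log (∫ x, Real.exp (-f x / ε) ∂μ) := by
    unfold softMin
    field_simp
  rw [h, Real.exp_log (integral_exp_neg_div_pos ε μ hf)]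

/-- Monotonicity and equivariance under constants in one inequality; the Lipschitz, oscillation and
sup bounds on potentials come from it. The a.e. hypothesis allows bounds known only on the support.
-/
theorem softMin_le_add (hε : 0 < ε) (hf : Continuous f) (hg : Continuous g) {k : ℝ}
    (h : ∀ᵐ x ∂μ, f x ≤ g x + k) : softMin ε μ f ≤ softMin ε μ g + k := by
  have h1 : Real.exp (-k / ε) * ∫ x, Real.exp (-g x / ε) ∂μ ≤ ∫ x, Real.exp (-f x / ε) ∂μ := by
    rw [← integral_const_mul]
    refine integral_mono_ae (integrable_of_continuous (by fun_prop) μ)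
      (integrable_of_continuous (by fun_prop) μ) ?_
    filter_upwards [h] with x hx
    rw [← Real.exp_add, ← add_div]
    gcongr
    linarith
  rw [← exp_neg_softMin_div hε μ hf, ← exp_neg_softMin_div hε μ hg, ← Real.exp_add,
    Real.exp_le_exp, ← add_div, div_le_div_iff_of_pos_right hε] at h1
  linarith

theorem softMin_le_of_ae_le (hε : 0 < ε) (hf : Continuous f) {a : ℝ}
    (h : ∀ᵐ x ∂μ, f x ≤ a) : softMin ε μ f ≤ a := by
  have := softMin_le_add (g := fun _ : X => a) (k := 0) hε hf continuous_const (by simpa using h)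
  rwa [softMin_const hε, add_zero] at this

theorem le_softMin_of_ae_le (hε : 0 < ε) (hf : Continuous f) {a : ℝ}
    (h : ∀ᵐ x ∂μ, a ≤ f x) : a ≤ softMin ε μ f := by
  have := softMin_le_add (f := fun _ : X => a) (k := 0) hε continuous_const hf (by simpa using h)
  rwa [softMin_const hε, add_zero] at this

/-- Jensen's inequality for `exp`, proved with the tangent line at the mean. -/
theorem softMin_le_integral (hε : 0 < ε) (hf : Continuous f) :
    softMin ε μ f ≤ ∫ x, f x ∂μ := by
  set a := ∫ x, f x ∂μ with ha
  have h1 : Real.exp (-a / ε) ≤ ∫ x, Real.exp (-f x / ε) ∂μ := by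
    have h2 : ∫ x, Real.exp (-a / ε) * (1 + (a - f x) / ε) ∂μ = Real.exp (-a / ε) := by
      have hi : Integrable (fun x => (a - f x) / ε) μ :=
        integrable_of_continuous (by fun_prop) μ
      rw [integral_const_mul, integral_add (integrable_const _) hi, integral_div,
        integral_sub (integrable_const _) (integrable_of_continuous hf μ), ← ha]
      simp
    rw [← h2]
    refine integral_mono (integrable_of_continuous (by fun_prop) μ)
      (integrable_of_continuous (by fun_prop) μ) fun x => ?_
    have h3 : Real.exp (-f x / ε) = Real.exp (-a / ε) * Real.exp ((a - f x) / ε) := by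
      rw [← Real.exp_add]
      congr 1
      ring
    simp only [h3]
    gcongr
    linarith [Real.add_one_le_exp ((a - f x) / ε)]
  rw [← exp_neg_softMin_div hε μ hf, Real.exp_le_exp, div_le_div_iff_of_pos_right hε] at h1
  linarith

/-- Uses `|exp t - 1 - t| ≤ t ^ 2` for `|t| ≤ 1`, at `t = -f / ε`, then `log s ≤ s - 1`. It is the
quantitative input for `ε → ∞`. -/
theorem integral_sub_le_softMin (hε : 0 < ε) (hf : Continuous f) {M : ℝ} (hM : M ≤ ε)
    (h : ∀ᵐ x ∂μ, |f x| ≤ M) : ∫ x, f x ∂μ - M ^ 2 / ε ≤ softMin ε μ f := by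
  set a := ∫ x, f x ∂μ with ha
  have h1 : ∫ x, Real.exp (-f x / ε) ∂μ ≤ 1 + (-a / ε + M ^ 2 / ε ^ 2) := by
    have hi : Integrable (fun x => -f x / ε) μ := integrable_of_continuous (by fun_prop) μ
    have h2 : ∫ x, (1 + (-f x / ε + M ^ 2 / ε ^ 2)) ∂μ = 1 + (-a / ε + M ^ 2 / ε ^ 2) := by
      have hj : Integrable (fun x => -f x / ε + M ^ 2 / ε ^ 2) μ := hi.add (integrable_const _)
      rw [integral_add (integrable_const _) hj,
        integral_add hi (integrable_const _), integral_div, integral_neg, ← ha]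
      simp
    rw [← h2]
    refine integral_mono_ae (integrable_of_continuous (by fun_prop) μ)
      (integrable_of_continuous (by fun_prop) μ) ?_
    filter_upwards [h] with x hx
    have hx1 : |-f x / ε| ≤ 1 := by
      rw [abs_div, abs_neg, abs_of_pos hε, div_le_one hε]
      exact hx.trans hM
    have h3 := (abs_le.1 (Real.abs_exp_sub_one_sub_id_le hx1)).2
    have h4 : (-f x / ε) ^ 2 ≤ M ^ 2 / ε ^ 2 := by
      rw [div_pow, neg_sq, ← sq_abs (f x)]
      gcongr
    linarith
  have h5 := Real.log_le_sub_one_of_pos (integral_exp_neg_div_pos ε μ hf)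
  have h6 : ε * Real.log (∫ x, Real.exp (-f x / ε) ∂μ) ≤ ε * (-a / ε + M ^ 2 / ε ^ 2) := by
    gcongr
    linarith
  have h7 : ε * (-a / ε + M ^ 2 / ε ^ 2) = -a + M ^ 2 / ε := by
    field_simp
  unfold softMin
  linarith

end SoftMin

/-! ### Regularity of the cost and of the Gibbs density. -/

section Cost

variable {X : Type*} [MetricSpace X] {c : X → X → ℝ} {L : NNReal}

theorem abs_cost_sub_le (hc : LipschitzWith L fun p : X × X => c p.1 p.2) (x y y' : X) :
    |c x y - c x y'| ≤ L * dist y y' := by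
  simpa [Real.dist_eq, Prod.dist_eq] using hc.dist_le_mul (x, y) (x, y')

theorem continuous_cost_sub_left (hc : LipschitzWith L fun p : X × X => c p.1 p.2) (φ : C(X, ℝ))
    (y : X) : Continuous fun x => c x y - φ x :=
  (hc.continuous.comp (by fun_prop : Continuous fun x : X => (x, y))).sub φ.continuous

theorem continuous_density (hc : LipschitzWith L fun p : X × X => c p.1 p.2) (ε : ℝ)
    (φ ψ : C(X, ℝ)) :
    Continuous fun p : X × X => Real.exp ((φ p.1 + ψ p.2 - c p.1 p.2) / ε) := by
  have := hc.continuous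
  fun_prop

end Cost

theorem eqOn_support_of_ae_eq {X : Type*} [TopologicalSpace X] [MeasurableSpace X]
    {μ : Measure X} {f g : X → ℝ} (hf : Continuous f) (hg : Continuous g)
    (h : f =ᵐ[μ] g) : Set.EqOn f g μ.support :=
  Measure.support_subset_of_isClosed (isClosed_eq hf hg) h

/-! ### Soft transforms and the optimality conditions. -/

section Dual

variable {X : Type*} [MetricSpace X] [CompactSpace X] [MeasurableSpace X] [BorelSpace X]
  {c : X → X → ℝ} {L : NNReal} {ε : ℝ} {μ ν : Measure X}
  [IsProbabilityMeasure μ] [IsProbabilityMeasure ν]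

/-- Only the cost depends on `y`, so the constant involves neither `ε` nor `φ`; this is the source
of all compactness. -/
theorem lipschitzWith_softMin (hc : LipschitzWith L fun p : X × X => c p.1 p.2) (hε : 0 < ε)
    (φ : C(X, ℝ)) : LipschitzWith L fun y => softMin ε μ fun x => c x y - φ x := by
  refine LipschitzWith.of_le_add_mul L fun y y' => ?_
  refine softMin_le_add hε (continuous_cost_sub_left hc φ y) (continuous_cost_sub_left hc φ y')
    (Eventually.of_forall fun x => ?_)
  linarith [le_of_abs_le (abs_cost_sub_le hc x y y')]

/-- The soft `c`-transform of `φ`, that is `y ↦ -ε log ∫ exp((φ(x) - c(x, y)) / ε) dμ(x)`. -/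
noncomputable def softTransform (hc : LipschitzWith L fun p : X × X => c p.1 p.2) (hε : 0 < ε)
    (μ : Measure X) [IsProbabilityMeasure μ] (φ : C(X, ℝ)) : C(X, ℝ) :=
  ⟨fun y => softMin ε μ fun x => c x y - φ x, (lipschitzWith_softMin hc hε φ).continuous⟩

theorem lipschitzWith_softTransform (hc : LipschitzWith L fun p : X × X => c p.1 p.2)
    (hε : 0 < ε) (φ : C(X, ℝ)) : LipschitzWith L (softTransform hc hε μ φ) :=
  lipschitzWith_softMin hc hε φ

theorem softTransform_apply (hc : LipschitzWith L fun p : X × X => c p.1 p.2) (hε : 0 < ε)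
    (φ : C(X, ℝ)) (y : X) :
    softTransform hc hε μ φ y = softMin ε μ fun x => c x y - φ x := rfl

theorem softTransform_le_add (hc : LipschitzWith L fun p : X × X => c p.1 p.2) (hε : 0 < ε)
    {φ φ' : C(X, ℝ)} {k : ℝ} (h : ∀ x, φ' x ≤ φ x + k) (y : X) :
    softTransform hc hε μ φ y ≤ softTransform hc hε μ φ' y + k :=
  softMin_le_add hε (continuous_cost_sub_left hc φ y) (continuous_cost_sub_left hc φ' y)
    (Eventually.of_forall fun x => by linarith [h x])

theorem integral_density_left (hc : LipschitzWith L fun p : X × X => c p.1 p.2) (hε : 0 < ε)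
    (φ ψ : C(X, ℝ)) (y : X) :
    ∫ x, Real.exp ((φ x + ψ y - c x y) / ε) ∂μ =
      Real.exp ((ψ y - softTransform hc hε μ φ y) / ε) := by
  have h1 : ∀ x, Real.exp ((φ x + ψ y - c x y) / ε) =
      Real.exp (ψ y / ε) * Real.exp (-(c x y - φ x) / ε) := fun x => by
    rw [← Real.exp_add]
    congr 1
    ring
  simp_rw [h1]
  rw [integral_const_mul, ← exp_neg_softMin_div hε μ (continuous_cost_sub_left hc φ y),
    ← Real.exp_add, ← softTransform_apply hc hε]
  congr 1
  ring

theorem entropicDual_eq (hc : LipschitzWith L fun p : X × X => c p.1 p.2) (hε : 0 < ε)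
    (φ ψ : C(X, ℝ)) :
    entropicDual c ε μ ν φ ψ = ∫ x, φ x ∂μ + ∫ y, ψ y ∂ν
      - ε * ∫ y, (Real.exp ((ψ y - softTransform hc hε μ φ y) / ε) - 1) ∂ν := by
  have hd := continuous_density hc ε φ ψ
  unfold entropicDual
  rw [integral_prod_symm _ (integrable_of_continuous (by fun_prop) _)]
  congr 3
  ext y
  have hy : Continuous fun x => Real.exp ((φ x + ψ y - c x y) / ε) :=
    hd.comp (by fun_prop : Continuous fun x : X => (x, y))
  rw [integral_sub (integrable_of_continuous hy μ) (integrable_const _),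
    integral_density_left hc hε]
  simp

theorem entropicDual_softTransform (hc : LipschitzWith L fun p : X × X => c p.1 p.2)
    (hε : 0 < ε) (φ : C(X, ℝ)) :
    entropicDual c ε μ ν φ (softTransform hc hε μ φ) =
      ∫ x, φ x ∂μ + ∫ y, softTransform hc hε μ φ y ∂ν := by
  simp [entropicDual_eq hc hε]

/-- The integrand is `exp t - (t + 1)`, nonnegative and zero only at `t = 0`. Its sign makes the
transform an improvement; its zero set identifies the optimizers. -/
theorem entropicDual_softTransform_sub (hc : LipschitzWith L fun p : X × X => c p.1 p.2)
    (hε : 0 < ε) (φ ψ : C(X, ℝ)) :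
    entropicDual c ε μ ν φ (softTransform hc hε μ φ) - entropicDual c ε μ ν φ ψ =
      ε * ∫ y, (Real.exp ((ψ y - softTransform hc hε μ φ y) / ε) -
        ((ψ y - softTransform hc hε μ φ y) / ε + 1)) ∂ν := by
  set T := softTransform hc hε μ φ
  have h1 : Integrable (fun y => Real.exp ((ψ y - T y) / ε) - 1) ν :=
    integrable_of_continuous (by fun_prop) ν
  have h2 : Integrable (fun y => (ψ y - T y) / ε) ν :=
    integrable_of_continuous (by fun_prop) ν
  have h3 : ∀ y, Real.exp ((ψ y - T y) / ε) - ((ψ y - T y) / ε + 1) =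
      (Real.exp ((ψ y - T y) / ε) - 1) - (ψ y - T y) / ε := fun y => by ring
  simp_rw [h3]
  rw [entropicDual_softTransform hc hε, entropicDual_eq hc hε, integral_sub h1 h2, integral_div,
    integral_sub (integrable_of_continuous ψ.continuous ν)
      (integrable_of_continuous T.continuous ν)]
  field_simp
  ring

theorem entropicDual_le_softTransform (hc : LipschitzWith L fun p : X × X => c p.1 p.2)
    (hε : 0 < ε) (φ ψ : C(X, ℝ)) :
    entropicDual c ε μ ν φ ψ ≤ entropicDual c ε μ ν φ (softTransform hc hε μ φ) := by
  rw [← sub_nonneg, entropicDual_softTransform_sub hc hε]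
  exact mul_nonneg hε.le
    (integral_nonneg fun y => sub_nonneg.2 (Real.add_one_le_exp _))

theorem entropicDual_swap (hs : ∀ x y, c x y = c y x) (φ ψ : C(X, ℝ)) :
    entropicDual c ε ν μ ψ φ = entropicDual c ε μ ν φ ψ := by
  unfold entropicDual
  rw [← integral_prod_swap, add_comm (∫ x, ψ x ∂ν)]
  simp only [Prod.fst_swap, Prod.snd_swap]
  congr 3
  ext p
  rw [hs p.2 p.1, add_comm (ψ p.2)]

theorem IsEntropicOptimal.swap (hs : ∀ x y, c x y = c y x) {φ ψ : C(X, ℝ)}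
    (h : IsEntropicOptimal c ε μ ν φ ψ) : IsEntropicOptimal c ε ν μ ψ φ := fun φ' ψ' => by
  rw [entropicDual_swap hs ψ' φ', entropicDual_swap hs φ ψ]
  exact h ψ' φ'

theorem IsEntropicOptimal.ae_eq_softTransform
    (hc : LipschitzWith L fun p : X × X => c p.1 p.2) (hε : 0 < ε) {φ ψ : C(X, ℝ)}
    (h : IsEntropicOptimal c ε μ ν φ ψ) : ψ =ᵐ[ν] softTransform hc hε μ φ := by
  set T := softTransform hc hε μ φ with hT
  have h1 := entropicDual_softTransform_sub (μ := μ) (ν := ν) hc hε φ ψ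
  rw [← hT] at h1
  have h0 : 0 ≤ fun y => Real.exp ((ψ y - T y) / ε) - ((ψ y - T y) / ε + 1) :=
    fun y => sub_nonneg.2 (Real.add_one_le_exp _)
  have h2 : ∫ y, (Real.exp ((ψ y - T y) / ε) - ((ψ y - T y) / ε + 1)) ∂ν = 0 := by
    refine le_antisymm ?_ (integral_nonneg h0)
    by_contra! hlt
    linarith [mul_pos hε hlt, h φ T]
  rw [integral_eq_zero_iff_of_nonneg h0 (integrable_of_continuous (by fun_prop) ν)] at h2
  filter_upwards [h2] with y hy
  by_contra hne
  have h3 : (ψ y - T y) / ε ≠ 0 := div_ne_zero (sub_ne_zero.2 hne) hε.ne'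
  have h4 := Real.add_one_lt_exp h3
  simp only [Pi.zero_apply] at hy
  linarith

theorem IsEntropicOptimal.eq_softMin_right
    (hc : LipschitzWith L fun p : X × X => c p.1 p.2) (hε : 0 < ε) {φ ψ : C(X, ℝ)}
    (h : IsEntropicOptimal c ε μ ν φ ψ) {y : X} (hy : y ∈ ν.support) :
    ψ y = softMin ε μ fun x => c x y - φ x :=
  eqOn_support_of_ae_eq ψ.continuous (softTransform hc hε μ φ).continuous
    (h.ae_eq_softTransform hc hε) hy

end Dual

/-! ### Compactness of Lipschitz families and continuity of the functionals. -/

section Compactness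

variable {X : Type*} [MetricSpace X]

theorem isCompact_setOf_lipschitzWith_mem_Icc (L : NNReal) (a b : ℝ) :
    IsCompact {f : C(X, ℝ) | LipschitzWith L f ∧ ∀ x, f x ∈ Set.Icc a b} := by
  refine ArzelaAscoli.isCompact_of_equicontinuous _ ?_ ?_
  · have h : ContinuousMap.toFun '' {f : C(X, ℝ) | LipschitzWith L f ∧ ∀ x, f x ∈ Set.Icc a b} =
        {f : X → ℝ | LipschitzWith L f} ∩ Set.univ.pi fun _ => Set.Icc a b := by
      ext f
      constructor
      · rintro ⟨g, ⟨hg, hg'⟩, rfl⟩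
        exact ⟨hg, fun x _ => hg' x⟩
      · rintro ⟨hf, hf'⟩
        exact ⟨⟨f, hf.continuous⟩, ⟨hf, fun x => hf' x trivial⟩, rfl⟩
    rw [h]
    exact (isCompact_univ_pi fun _ => isCompact_Icc).inter_left (isClosed_setOfPred_lipschitzWith L)
  · exact (LipschitzWith.uniformEquicontinuous _ L fun f => f.2.1).equicontinuous

variable [CompactSpace X] [MeasurableSpace X] [BorelSpace X]

theorem integral_le_integral_add {μ : Measure X} [IsProbabilityMeasure μ] {f g : C(X, ℝ)} {k : ℝ}
    (h : ∀ x, f x ≤ g x + k) : ∫ x, f x ∂μ ≤ ∫ x, g x ∂μ + k := by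
  have hg := integrable_of_continuous g.continuous μ
  calc ∫ x, f x ∂μ ≤ ∫ x, (g x + k) ∂μ :=
        integral_mono (integrable_of_continuous f.continuous μ) (hg.add (integrable_const k)) h
    _ = ∫ x, g x ∂μ + k := by simp [integral_add hg (integrable_const k)]

theorem continuous_integral_continuousMap (μ : Measure X) [IsProbabilityMeasure μ] :
    Continuous fun f : C(X, ℝ) => ∫ x, f x ∂μ := by
  refine (LipschitzWith.of_le_add fun f g => integral_le_integral_add fun x => ?_).continuous
  have := ContinuousMap.dist_apply_le_dist (f := f) (g := g) x
  rw [Real.dist_eq] at this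
  linarith [le_of_abs_le this]

theorem continuous_softTransform {c : X → X → ℝ} {L : NNReal} {ε : ℝ}
    (hc : LipschitzWith L fun p : X × X => c p.1 p.2) (hε : 0 < ε) (μ : Measure X)
    [IsProbabilityMeasure μ] : Continuous (softTransform hc hε μ) := by
  refine (LipschitzWith.of_dist_le_mul (K := 1) fun f g => ?_).continuous
  rw [NNReal.coe_one, one_mul, ContinuousMap.dist_le dist_nonneg]
  intro y
  have h : ∀ f g : C(X, ℝ), ∀ x, f x ≤ g x + dist f g := fun f g x => by
    have := ContinuousMap.dist_apply_le_dist (f := f) (g := g) x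
    rw [Real.dist_eq] at this
    linarith [le_of_abs_le this]
  rw [Real.dist_eq, abs_sub_le_iff]
  constructor
  · have := softTransform_le_add (μ := μ) hc hε (h g f) y
    rw [dist_comm] at this
    linarith
  · have := softTransform_le_add (μ := μ) hc hε (h f g) y
    linarith

theorem abs_sub_integral_le {L : NNReal} {f : C(X, ℝ)} (hf : LipschitzWith L f) (μ : Measure X)
    [IsProbabilityMeasure μ] (x : X) :
    |f x - ∫ z, f z ∂μ| ≤ L * Metric.diam (Set.univ : Set X) := by
  have h : ∀ z w, f z ≤ f w + L * Metric.diam (Set.univ : Set X) := fun z w => by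
    have h1 := (le_abs_self _).trans (Real.dist_eq (f z) (f w) ▸ hf.dist_le_mul z w)
    have h2 : dist z w ≤ Metric.diam (Set.univ : Set X) :=
      Metric.dist_le_diam_of_mem isCompact_univ.isBounded trivial trivial
    have h3 : (L : ℝ) * dist z w ≤ L * Metric.diam (Set.univ : Set X) := by gcongr
    linarith
  have h1 := integral_le_integral_add (μ := μ) (g := ContinuousMap.const X (f x)) fun z => h z x
  have h2 := integral_le_integral_add (μ := μ) (f := ContinuousMap.const X (f x)) fun z => h x z
  simp only [ContinuousMap.const_apply, integral_const, probReal_univ, smul_eq_mul,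
    one_mul] at h1 h2
  rw [abs_sub_le_iff]
  constructor <;> linarith

end Compactness

/-! ### Existence of normalized potentials with uniform bounds. -/

section Existence

variable {X : Type*} [MetricSpace X] [CompactSpace X] [MeasurableSpace X] [BorelSpace X]
  {c : X → X → ℝ} {L : NNReal} {ε : ℝ} {μ ν : Measure X}
  [IsProbabilityMeasure μ] [IsProbabilityMeasure ν]

/-- Alternating maximization: the second transform makes the first potential `L`-Lipschitz, and the
third reduces the dual value to a sum of two integrals. -/
theorem entropicDual_le_of_softTransform_twice
    (hc : LipschitzWith L fun p : X × X => c p.1 p.2) (hs : ∀ x y, c x y = c y x) (hε : 0 < ε)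
    (φ ψ : C(X, ℝ)) :
    let φ' := softTransform hc hε ν (softTransform hc hε μ φ)
    entropicDual c ε μ ν φ ψ ≤ ∫ x, φ' x ∂μ + ∫ y, softTransform hc hε μ φ' y ∂ν := by
  intro φ'
  have h1 := entropicDual_le_softTransform (μ := μ) (ν := ν) hc hε φ ψ
  have h2 := entropicDual_le_softTransform (μ := ν) (ν := μ) hc hε (softTransform hc hε μ φ) φ
  rw [entropicDual_swap hs φ, entropicDual_swap hs φ'] at h2
  have h3 := entropicDual_le_softTransform (μ := μ) (ν := ν) hc hε φ' (softTransform hc hε μ φ)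
  rw [entropicDual_softTransform] at h3
  linarith

theorem softTransform_add_const (hc : LipschitzWith L fun p : X × X => c p.1 p.2) (hε : 0 < ε)
    (φ : C(X, ℝ)) (k : ℝ) :
    softTransform hc hε μ (φ + ContinuousMap.const X k) =
      softTransform hc hε μ φ + ContinuousMap.const X (-k) := by
  ext y
  refine le_antisymm ?_ ?_
  · exact softTransform_le_add hc hε (fun x => by simp) y
  · have := softTransform_le_add (μ := μ) hc hε (φ := φ) (φ' := φ + ContinuousMap.const X k)
      (k := k) (fun x => by simp) y
    simp only [ContinuousMap.add_apply, ContinuousMap.const_apply]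
    linarith

theorem integral_add_const (φ : C(X, ℝ)) (k : ℝ) :
    ∫ x, (φ + ContinuousMap.const X k) x ∂μ = ∫ x, φ x ∂μ + k := by
  simp [integral_add (integrable_of_continuous φ.continuous μ) (integrable_const k)]

/-- Normalized optimal potentials exist, and can be taken `L`-Lipschitz with values in a bounded
interval that does not depend on `ε`. -/
theorem exists_isEntropicOptimal (hc : LipschitzWith L fun p : X × X => c p.1 p.2)
    (hs : ∀ x y, c x y = c y x) (μ ν : Measure X) [IsProbabilityMeasure μ]
    [IsProbabilityMeasure ν] :
    ∃ R : ℝ, ∀ ε : ℝ, 0 < ε → ∃ φ ψ : C(X, ℝ), IsEntropicOptimal c ε μ ν φ ψ ∧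
      IsNormalized c μ ν φ ∧ (LipschitzWith L φ ∧ ∀ x, φ x ∈ Set.Icc (-R) R) ∧
      LipschitzWith L ψ ∧ ∀ y, ψ y ∈ Set.Icc (-R) R := by
  obtain ⟨C, hC⟩ := isCompact_univ.exists_bound_of_continuousOn hc.continuous.continuousOn
  have hC' : ∀ x y, |c x y| ≤ C := fun x y => by simpa using hC (x, y) trivial
  set m := 1 / 2 * OTInf c μ ν with hm
  set D := L * Metric.diam (Set.univ : Set X) with hD
  obtain ⟨x₀⟩ : Nonempty X := nonempty_of_isProbabilityMeasure μ
  have hC0 : 0 ≤ C := (abs_nonneg _).trans (hC' x₀ x₀)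
  -- An `L`-Lipschitz function of mean `m` stays within `D` of `m`. The further `C` in the final
  -- radius accounts for the soft transform.
  set R₀ := |m| + D with hR₀
  let K : Set C(X, ℝ) := {f | LipschitzWith L f ∧ ∀ x, f x ∈ Set.Icc (-R₀) R₀} ∩
    {f | ∫ x, f x ∂μ = m}
  have hK : IsCompact K := (isCompact_setOf_lipschitzWith_mem_Icc L _ _).inter_right
    (isClosed_eq (continuous_integral_continuousMap μ) continuous_const)
  have hmem : ∀ f : C(X, ℝ), LipschitzWith L f → ∫ x, f x ∂μ = m → f ∈ K := fun f hf hfm => by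
    refine ⟨⟨hf, fun x => ?_⟩, hfm⟩
    have h1 := abs_le.1 (abs_sub_integral_le hf μ x)
    have h2 := abs_le.1 (le_refl |m|)
    rw [hfm] at h1
    constructor <;> linarith
  have hne : K.Nonempty :=
    ⟨ContinuousMap.const X m, hmem _ (LipschitzWith.const' m) (by simp)⟩
  refine ⟨R₀ + C, fun ε hε => ?_⟩
  obtain ⟨φ, hφK, hφ⟩ := hK.exists_isMaxOn hne
    (f := fun φ => ∫ x, φ x ∂μ + ∫ y, softTransform hc hε μ φ y ∂ν)
    ((continuous_integral_continuousMap μ).add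
      ((continuous_integral_continuousMap ν).comp (continuous_softTransform hc hε μ))).continuousOn
  refine ⟨φ, softTransform hc hε μ φ, fun φ' ψ' => ?_, hφK.2,
    ⟨hφK.1.1, fun x => ⟨?_, ?_⟩⟩, lipschitzWith_softTransform hc hε φ, fun y => ⟨?_, ?_⟩⟩
  · refine (entropicDual_le_of_softTransform_twice hc hs hε φ' ψ').trans ?_
    rw [entropicDual_softTransform]
    set φ₂ := softTransform hc hε ν (softTransform hc hε μ φ') with hφ₂
    -- Shifting by `k` restores the normalization; the transform shifts by `-k`, so the value is
    -- unchanged.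
    set k := m - ∫ x, φ₂ x ∂μ with hk
    have hk₂ : φ₂ + ContinuousMap.const X k ∈ K := by
      refine hmem _ ?_ (by rw [integral_add_const]; ring)
      exact LipschitzWith.of_dist_le_mul fun x y => by
        simpa using (lipschitzWith_softTransform (μ := ν) hc hε
          (softTransform hc hε μ φ')).dist_le_mul x y
    have h := hφ hk₂
    simp only [Set.mem_ofPred_eq] at h
    rw [softTransform_add_const, integral_add_const, integral_add_const] at h
    linarith
  · linarith [(hφK.1.2 x).1]
  · linarith [(hφK.1.2 x).2]
  · refine le_softMin_of_ae_le hε (continuous_cost_sub_left hc φ y)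
      (Eventually.of_forall fun x => ?_)
    linarith [(hφK.1.2 x).2, (abs_le.1 (hC' x y)).1]
  · refine softMin_le_of_ae_le hε (continuous_cost_sub_left hc φ y)
      (Eventually.of_forall fun x => ?_)
    linarith [(hφK.1.2 x).1, (abs_le.1 (hC' x y)).2]

end Existence

/-! ### Uniqueness on the supports. -/

section Uniqueness

variable {X : Type*} [MetricSpace X] [CompactSpace X] [MeasurableSpace X] [BorelSpace X]
  {c : X → X → ℝ} {L : NNReal} {ε : ℝ} {μ ν : Measure X}
  [IsProbabilityMeasure μ] [IsProbabilityMeasure ν]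

/-- Concavity with its exact defect, from `(exp (a/2) - exp (b/2)) ^ 2 = exp a + exp b - 2 * exp
((a+b)/2)`. -/
theorem entropicDual_midpoint (hc : LipschitzWith L fun p : X × X => c p.1 p.2)
    (φ ψ φ' ψ' : C(X, ℝ)) :
    entropicDual c ε μ ν ((1 / 2 : ℝ) • (φ + φ')) ((1 / 2 : ℝ) • (ψ + ψ')) =
      1 / 2 * (entropicDual c ε μ ν φ ψ + entropicDual c ε μ ν φ' ψ') +
      ε / 2 * ∫ p, (Real.exp ((φ p.1 + ψ p.2 - c p.1 p.2) / ε / 2) -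
        Real.exp ((φ' p.1 + ψ' p.2 - c p.1 p.2) / ε / 2)) ^ 2 ∂(μ.prod ν) := by
  have hcc := hc.continuous
  have hi := fun f : C(X, ℝ) => integrable_of_continuous f.continuous μ
  have hj := fun f : C(X, ℝ) => integrable_of_continuous f.continuous ν
  have hd : ∀ f g : C(X, ℝ), Integrable
      (fun p : X × X => Real.exp ((f p.1 + g p.2 - c p.1 p.2) / ε) - 1) (μ.prod ν) :=
    fun f g => integrable_of_continuous (by fun_prop) _
  have hsq : ∫ p, (Real.exp ((φ p.1 + ψ p.2 - c p.1 p.2) / ε / 2) -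
        Real.exp ((φ' p.1 + ψ' p.2 - c p.1 p.2) / ε / 2)) ^ 2 ∂(μ.prod ν) =
      ∫ p, (Real.exp ((φ p.1 + ψ p.2 - c p.1 p.2) / ε) - 1) ∂(μ.prod ν) +
      ∫ p, (Real.exp ((φ' p.1 + ψ' p.2 - c p.1 p.2) / ε) - 1) ∂(μ.prod ν) -
      2 * ∫ p, (Real.exp ((((1 / 2 : ℝ) • (φ + φ')) p.1 + ((1 / 2 : ℝ) • (ψ + ψ')) p.2
        - c p.1 p.2) / ε) - 1) ∂(μ.prod ν) := by
    have hadd : Integrable (fun p : X × X => Real.exp ((φ p.1 + ψ p.2 - c p.1 p.2) / ε) - 1 +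
        (Real.exp ((φ' p.1 + ψ' p.2 - c p.1 p.2) / ε) - 1)) (μ.prod ν) :=
      (hd φ ψ).add (hd φ' ψ')
    rw [← integral_const_mul, ← integral_add (hd φ ψ) (hd φ' ψ'), ← integral_sub
      hadd ((hd _ _).const_mul 2)]
    congr 1
    ext p
    have e1 : ∀ t : ℝ, Real.exp t = Real.exp (t / 2) ^ 2 := fun t => by
      rw [sq, ← Real.exp_add, add_halves]
    have e2 : Real.exp ((((1 / 2 : ℝ) • (φ + φ')) p.1 + ((1 / 2 : ℝ) • (ψ + ψ')) p.2
        - c p.1 p.2) / ε) = Real.exp ((φ p.1 + ψ p.2 - c p.1 p.2) / ε / 2) *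
          Real.exp ((φ' p.1 + ψ' p.2 - c p.1 p.2) / ε / 2) := by
      rw [← Real.exp_add]
      congr 1
      simp only [ContinuousMap.smul_apply, ContinuousMap.add_apply, smul_eq_mul]
      ring
    rw [e2, e1 ((φ p.1 + ψ p.2 - c p.1 p.2) / ε), e1 ((φ' p.1 + ψ' p.2 - c p.1 p.2) / ε)]
    ring
  rw [hsq]
  unfold entropicDual
  have i1 : ∫ x, ((1 / 2 : ℝ) • (φ + φ')) x ∂μ = 1 / 2 * (∫ x, φ x ∂μ + ∫ x, φ' x ∂μ) := by
    simp only [ContinuousMap.smul_apply, ContinuousMap.add_apply, smul_eq_mul]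
    rw [integral_const_mul, integral_add (hi φ) (hi φ')]
  have i2 : ∫ x, ((1 / 2 : ℝ) • (ψ + ψ')) x ∂ν = 1 / 2 * (∫ x, ψ x ∂ν + ∫ x, ψ' x ∂ν) := by
    simp only [ContinuousMap.smul_apply, ContinuousMap.add_apply, smul_eq_mul]
    rw [integral_const_mul, integral_add (hj ψ) (hj ψ')]
  rw [i1, i2]
  ring

/-- At two maximizers the midpoint defect vanishes, so the sums `φ + ψ` and `φ' + ψ'` agree a.e.
Then `φ - φ'` is a.e. constant, and equal means make that constant zero. -/
theorem IsEntropicOptimal.eqOn_support (hc : LipschitzWith L fun p : X × X => c p.1 p.2)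
    (hε : 0 < ε) {φ ψ φ' ψ' : C(X, ℝ)} (h : IsEntropicOptimal c ε μ ν φ ψ)
    (h' : IsEntropicOptimal c ε μ ν φ' ψ') (heq : ∫ x, φ x ∂μ = ∫ x, φ' x ∂μ) :
    Set.EqOn φ φ' μ.support ∧ Set.EqOn ψ ψ' ν.support := by
  have hcc := hc.continuous
  have hmid := entropicDual_midpoint (ε := ε) (μ := μ) (ν := ν) hc φ ψ φ' ψ'
  set F : X × X → ℝ := fun p => (Real.exp ((φ p.1 + ψ p.2 - c p.1 p.2) / ε / 2) -
        Real.exp ((φ' p.1 + ψ' p.2 - c p.1 p.2) / ε / 2)) ^ 2 with hF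
  have hF0 : 0 ≤ F := fun p => sq_nonneg _
  have hFint : ∫ p, F p ∂(μ.prod ν) = 0 := by
    refine le_antisymm ?_ (integral_nonneg hF0)
    by_contra! hlt
    have h1 := h ((1 / 2 : ℝ) • (φ + φ')) ((1 / 2 : ℝ) • (ψ + ψ'))
    have h2 := h' φ ψ
    linarith [mul_pos (half_pos hε) hlt, h φ' ψ']
  rw [integral_eq_zero_iff_of_nonneg hF0 (integrable_of_continuous (by fun_prop) _)] at hFint
  have hsum : ∀ᵐ p ∂(μ.prod ν), φ p.1 + ψ p.2 = φ' p.1 + ψ' p.2 := by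
    filter_upwards [hFint] with p hp
    have h1 := Real.exp_injective (sub_eq_zero.1 (pow_eq_zero_iff two_ne_zero |>.1 hp))
    field_simp at h1
    linarith
  have hφ : φ =ᵐ[μ] φ' := by
    have h1 : ∀ᵐ x ∂μ, φ x - φ' x = ∫ y, (ψ' y - ψ y) ∂ν := by
      filter_upwards [Measure.ae_ae_of_ae_prod hsum] with x hx
      have : ∀ᵐ y ∂ν, ψ' y - ψ y = φ x - φ' x := by
        filter_upwards [hx] with y hy
        linarith
      simp [integral_congr_ae this]
    have h2 := integral_congr_ae h1
    rw [integral_sub (integrable_of_continuous φ.continuous μ)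
      (integrable_of_continuous φ'.continuous μ), heq, sub_self] at h2
    simp only [integral_const, probReal_univ, smul_eq_mul, one_mul] at h2
    filter_upwards [h1] with x hx
    linarith
  have hψ : ψ =ᵐ[ν] ψ' := by
    have h1 : ∀ᵐ x ∂μ, ∀ᵐ y ∂ν, ψ y = ψ' y := by
      filter_upwards [hφ, Measure.ae_ae_of_ae_prod hsum] with x hx1 hx2
      filter_upwards [hx2] with y hy
      linarith
    exact h1.exists.choose_spec
  exact ⟨eqOn_support_of_ae_eq φ.continuous φ'.continuous hφ,
    eqOn_support_of_ae_eq ψ.continuous ψ'.continuous hψ⟩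

end Uniqueness

/-! ### The limit `ε → ∞`. -/

section LargeRegularization

variable {X : Type*} [MetricSpace X] [CompactSpace X] [MeasurableSpace X] [BorelSpace X]
  {c : X → X → ℝ} {L : NNReal} {ε : ℝ} {μ ν : Measure X}
  [IsProbabilityMeasure μ] [IsProbabilityMeasure ν]

theorem abs_softMin_sub_integral_le (hε : 0 < ε) {f : X → ℝ} (hf : Continuous f) {M : ℝ}
    (hM : M ≤ ε) (h : ∀ᵐ x ∂μ, |f x| ≤ M) : |softMin ε μ f - ∫ x, f x ∂μ| ≤ M ^ 2 / ε := by
  have h1 := softMin_le_integral (μ := μ) hε hf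
  have h2 := integral_sub_le_softMin hε hf hM h
  have h3 : 0 ≤ M ^ 2 / ε := by positivity
  rw [abs_sub_le_iff]
  constructor <;> linarith

theorem abs_integral_sub_integral_le {f g : X → ℝ} (hf : Continuous f) (hg : Continuous g) {k : ℝ}
    (h : ∀ᵐ x ∂μ, |f x - g x| ≤ k) : |∫ x, f x ∂μ - ∫ x, g x ∂μ| ≤ k := by
  rw [← integral_sub (integrable_of_continuous hf μ) (integrable_of_continuous hg μ)]
  have h' : ∀ᵐ x ∂μ, ‖f x - g x‖ ≤ k := h
  simpa using norm_integral_le_of_norm_le_const h'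

theorem IsEntropicOptimal.eq_softMin_left
    (hc : LipschitzWith L fun p : X × X => c p.1 p.2) (hs : ∀ x y, c x y = c y x) (hε : 0 < ε)
    {φ ψ : C(X, ℝ)} (h : IsEntropicOptimal c ε μ ν φ ψ) {x : X} (hx : x ∈ μ.support) :
    φ x = softMin ε ν fun y => c x y - ψ y := by
  rw [(h.swap hs).eq_softMin_right hc hε hx]
  simp_rw [hs x]

theorem continuous_integral_cost (hc : LipschitzWith L fun p : X × X => c p.1 p.2)
    (ν : Measure X) [IsProbabilityMeasure ν] : Continuous fun x => ∫ y, c x y ∂ν := by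
  refine (LipschitzWith.of_le_add_mul L fun x x' => ?_).continuous
  have hcc := hc.continuous
  have := integral_le_integral_add (μ := ν) (f := ⟨fun y => c x y, by fun_prop⟩)
    (g := ⟨fun y => c x' y, by fun_prop⟩) (k := L * dist x x') fun y => by
      have h1 := hc.dist_le_mul (x, y) (x', y)
      simp only [Real.dist_eq, Prod.dist_eq, dist_self, dist_nonneg, sup_of_le_left] at h1
      simp only [ContinuousMap.coe_mk]
      linarith [le_of_abs_le h1]
  simpa using this

theorem OTInf_eq_integral_integral (hc : LipschitzWith L fun p : X × X => c p.1 p.2) :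
    OTInf c μ ν = ∫ x, ∫ y, c x y ∂ν ∂μ :=
  integral_prod _ (integrable_of_continuous hc.continuous _)

theorem exists_abs_sub_le_of_isEntropicOptimal (hc : LipschitzWith L fun p : X × X => c p.1 p.2)
    (hs : ∀ x y, c x y = c y x) (μ ν : Measure X) [IsProbabilityMeasure μ]
    [IsProbabilityMeasure ν] :
    ∃ M : ℝ, ∀ ε : ℝ, 0 < ε → M ≤ ε → ∀ φ ψ : C(X, ℝ), IsEntropicOptimal c ε μ ν φ ψ →
      IsNormalized c μ ν φ →
      (∀ x ∈ μ.support, |φ x - (∫ y, c x y ∂ν - 1 / 2 * OTInf c μ ν)| ≤ 2 * (M ^ 2 / ε)) ∧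
      ∀ y ∈ ν.support, |ψ y - (∫ x, c x y ∂μ - 1 / 2 * OTInf c μ ν)| ≤ 2 * (M ^ 2 / ε) := by
  have hcc := hc.continuous
  obtain ⟨C, hC⟩ := isCompact_univ.exists_bound_of_continuousOn hcc.continuousOn
  have hC' : ∀ x y, |c x y| ≤ C := fun x y => by simpa using hC (x, y) trivial
  obtain ⟨x₀⟩ : Nonempty X := nonempty_of_isProbabilityMeasure μ
  have hC0 : 0 ≤ C := (abs_nonneg _).trans (hC' x₀ x₀)
  have hOT : |OTInf c μ ν| ≤ C := by
    simpa [OTInf] using norm_integral_le_of_norm_le_const (μ := μ.prod ν)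
      (Eventually.of_forall fun p : X × X => hC p trivial)
  -- With `C` bounding the cost, `φ` oscillates by at most `2C` about its mean `m`, and `|m| ≤ C/2`;
  -- so `|φ| ≤ 3C`, then `|ψ| ≤ 4C`, and both soft-min arguments are at most `5C` in absolute value.
  refine ⟨5 * C, fun ε hε hM φ ψ hopt hnorm => ?_⟩
  have hμ : ∀ᵐ x ∂μ, x ∈ μ.support := Measure.support_mem_ae
  have hν : ∀ᵐ y ∂ν, y ∈ ν.support := Measure.support_mem_ae
  unfold IsNormalized at hnorm
  set m := 1 / 2 * OTInf c μ ν with hm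
  have hφc : ∀ x, Continuous fun y => c x y - ψ y := fun x => by fun_prop
  have hosc : ∀ x ∈ μ.support, ∀ x' ∈ μ.support, φ x ≤ φ x' + 2 * C := fun x hx x' hx' => by
    rw [hopt.eq_softMin_left hc hs hε hx, hopt.eq_softMin_left hc hs hε hx']
    refine softMin_le_add hε (hφc x) (hφc x') (Eventually.of_forall fun y => ?_)
    linarith [(abs_le.1 (hC' x y)).2, (abs_le.1 (hC' x' y)).1]
  have hφ : ∀ x ∈ μ.support, |φ x| ≤ 3 * C := fun x hx => by
    have h1 : |φ x - m| ≤ 2 * C := by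
      have := abs_integral_sub_integral_le (μ := μ) (f := fun _ => φ x) (g := φ) (k := 2 * C)
        continuous_const φ.continuous (by
          filter_upwards [hμ] with z hz
          rw [abs_sub_le_iff]
          constructor <;> linarith [hosc x hx z hz, hosc z hz x hx])
      simpa [hnorm] using this
    have h2 := abs_le.1 h1
    have h3 := abs_le.1 hOT
    rw [abs_le]
    constructor <;> linarith
  have hψ : ∀ y ∈ ν.support, |ψ y| ≤ 4 * C := fun y hy => by
    rw [hopt.eq_softMin_right hc hε hy, abs_le]
    constructor
    · refine le_softMin_of_ae_le hε (continuous_cost_sub_left hc φ y) ?_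
      filter_upwards [hμ] with x hx
      linarith [(abs_le.1 (hC' x y)).1, (abs_le.1 (hφ x hx)).2]
    · refine softMin_le_of_ae_le hε (continuous_cost_sub_left hc φ y) ?_
      filter_upwards [hμ] with x hx
      linarith [(abs_le.1 (hC' x y)).2, (abs_le.1 (hφ x hx)).1]
  have hφ' : ∀ x ∈ μ.support,
      |φ x - (∫ y, c x y ∂ν - ∫ y, ψ y ∂ν)| ≤ (5 * C) ^ 2 / ε := fun x hx => by
    rw [← integral_sub (integrable_of_continuous (by fun_prop) ν)
      (integrable_of_continuous ψ.continuous ν), hopt.eq_softMin_left hc hs hε hx]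
    refine abs_softMin_sub_integral_le hε (hφc x) hM ?_
    filter_upwards [hν] with y hy
    have h1 := abs_le.1 (hC' x y)
    have h2 := abs_le.1 (hψ y hy)
    rw [abs_le]
    constructor <;> linarith
  have hψ' : ∀ y ∈ ν.support,
      |ψ y - (∫ x, c x y ∂μ - m)| ≤ (5 * C) ^ 2 / ε := fun y hy => by
    rw [← hnorm, ← integral_sub (integrable_of_continuous (by fun_prop) μ)
      (integrable_of_continuous φ.continuous μ), hopt.eq_softMin_right hc hε hy]
    refine abs_softMin_sub_integral_le hε (continuous_cost_sub_left hc φ y) hM ?_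
    filter_upwards [hμ] with x hx
    have h1 := abs_le.1 (hC' x y)
    have h2 := abs_le.1 (hφ x hx)
    rw [abs_le]
    constructor <;> linarith
  -- Averaging the estimate for `φ` over `μ` shows that the mean of `ψ` is also close to `m`; this
  -- second error explains the factor `2` in the conclusion.
  have hk : |m - (2 * m - ∫ y, ψ y ∂ν)| ≤ (5 * C) ^ 2 / ε := by
    have hcont := continuous_integral_cost hc ν
    have h1 := abs_integral_sub_integral_le (μ := μ)
      (g := fun x => ∫ y, c x y ∂ν - ∫ y, ψ y ∂ν) φ.continuous
      (hcont.sub continuous_const) (hμ.mono hφ')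
    rw [integral_sub (integrable_of_continuous hcont μ) (integrable_const _), hnorm,
      ← OTInf_eq_integral_integral hc] at h1
    simp only [integral_const, probReal_univ, smul_eq_mul, one_mul] at h1
    have h2 : 2 * m = OTInf c μ ν := by rw [hm]; ring
    rwa [h2]
  have h0 : 0 ≤ (5 * C) ^ 2 / ε := by positivity
  constructor
  · intro x hx
    have h1 := abs_le.1 (hφ' x hx)
    have h2 := abs_le.1 hk
    rw [abs_le]
    constructor <;> linarith
  · intro y hy
    linarith [hψ' y hy]

theorem tendstoUniformlyOn_atTop (hc : LipschitzWith L fun p : X × X => c p.1 p.2)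
    (hs : ∀ x y, c x y = c y x) {φ ψ : ℝ → C(X, ℝ)}
    (h : ∀ ε : ℝ, 0 < ε → IsEntropicOptimal c ε μ ν (φ ε) (ψ ε) ∧ IsNormalized c μ ν (φ ε)) :
    TendstoUniformlyOn (fun ε x => φ ε x)
        (fun x => ∫ y, c x y ∂ν - 1 / 2 * OTInf c μ ν) atTop μ.support ∧
      TendstoUniformlyOn (fun ε y => ψ ε y)
        (fun y => ∫ x, c x y ∂μ - 1 / 2 * OTInf c μ ν) atTop ν.support := by
  obtain ⟨M, hM⟩ := exists_abs_sub_le_of_isEntropicOptimal hc hs μ ν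
  have hlim : Tendsto (fun ε : ℝ => 2 * (M ^ 2 / ε)) atTop (𝓝 0) := by
    simpa using (tendsto_const_nhds.div_atTop tendsto_id).const_mul (2 : ℝ)
  constructor
  all_goals
    refine Metric.tendstoUniformlyOn_iff.2 fun δ hδ => ?_
    filter_upwards [hlim.eventually_lt_const hδ, eventually_gt_atTop 0, eventually_ge_atTop M]
      with ε h1 h2 h3 x hx
    rw [dist_comm, Real.dist_eq]
  · exact ((hM ε h2 h3 _ _ (h ε h2).1 (h ε h2).2).1 x hx).trans_lt h1
  · exact ((hM ε h2 h3 _ _ (h ε h2).1 (h ε h2).2).2 x hx).trans_lt h1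

end LargeRegularization

/-! ### Elementary bounds on the primal infima. -/

section PlanBounds

variable {X : Type*} [MeasurableSpace X] {c : X → X → ℝ} {ε : ℝ} {μ ν : Measure X}

theorem isProbabilityMeasure_of_mem_plans [IsProbabilityMeasure μ]
    {π : Measure (X × X)} (hπ : π ∈ plans μ ν) : IsProbabilityMeasure π :=
  ⟨by rw [← Measure.fst_univ, hπ.1, measure_univ]⟩

theorem OT_le (hc0 : ∀ x y, 0 ≤ c x y) {π : Measure (X × X)} (hπ : π ∈ plans μ ν) :
    OT c μ ν ≤ ∫ p, c p.1 p.2 ∂π := by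
  refine csInf_le ⟨0, ?_⟩ ⟨π, hπ, rfl⟩
  rintro r ⟨π', -, rfl⟩
  exact integral_nonneg fun p => hc0 p.1 p.2

theorem OTEps_le (hc0 : ∀ x y, 0 ≤ c x y) (hε : 0 < ε) {π : Measure (X × X)}
    (hπ : π ∈ plans μ ν) (hkl : InformationTheory.klDiv π (μ.prod ν) ≠ ⊤) :
    OTEps c ε μ ν ≤ ∫ p, c p.1 p.2 ∂π + ε * (InformationTheory.klDiv π (μ.prod ν)).toReal := by
  refine csInf_le ⟨0, ?_⟩ ⟨π, hπ, hkl, rfl⟩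
  rintro r ⟨π', -, -, rfl⟩
  have := integral_nonneg (μ := π') (f := fun p : X × X => c p.1 p.2) fun p => hc0 p.1 p.2
  positivity

variable [IsProbabilityMeasure μ] [IsProbabilityMeasure ν]

theorem prod_mem_plans : μ.prod ν ∈ plans μ ν := by
  simp [plans]

theorem le_OT {a : ℝ} (h : ∀ π ∈ plans μ ν, a ≤ ∫ p, c p.1 p.2 ∂π) : a ≤ OT c μ ν := by
  refine le_csInf ⟨_, μ.prod ν, prod_mem_plans, rfl⟩ ?_
  rintro r ⟨π, hπ, rfl⟩
  exact h π hπ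

theorem OT_le_OTEps (hc0 : ∀ x y, 0 ≤ c x y) (hε : 0 < ε) : OT c μ ν ≤ OTEps c ε μ ν := by
  refine le_csInf ⟨_, μ.prod ν, prod_mem_plans, by simp, rfl⟩ ?_
  rintro r ⟨π, hπ, -, rfl⟩
  have : 0 ≤ ε * (InformationTheory.klDiv π (μ.prod ν)).toReal := by positivity
  linarith [OT_le hc0 hπ]

end PlanBounds

/-! ### Weak duality and the Gibbs plan. -/

section Plans

variable {X : Type*} [MetricSpace X] [CompactSpace X] [MeasurableSpace X] [BorelSpace X]
  {c : X → X → ℝ} {L : NNReal} {ε : ℝ} {μ ν : Measure X}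
  [IsProbabilityMeasure μ]

theorem integral_add_of_mem_plans {π : Measure (X × X)} (hπ : π ∈ plans μ ν) (φ ψ : C(X, ℝ)) :
    ∫ p, (φ p.1 + ψ p.2) ∂π = ∫ x, φ x ∂μ + ∫ y, ψ y ∂ν := by
  have := isProbabilityMeasure_of_mem_plans hπ
  rw [integral_add (integrable_of_continuous (by fun_prop) π)
    (integrable_of_continuous (by fun_prop) π), ← hπ.1, ← hπ.2, Measure.fst, Measure.snd,
    integral_map measurable_fst.aemeasurable φ.continuous.aestronglyMeasurable,
    integral_map measurable_snd.aemeasurable ψ.continuous.aestronglyMeasurable]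

theorem IsFeasible.integral_le (hc : LipschitzWith L fun p : X × X => c p.1 p.2)
    {φ ψ : C(X, ℝ)} (h : IsFeasible c φ ψ) {π : Measure (X × X)} (hπ : π ∈ plans μ ν) :
    ∫ x, φ x ∂μ + ∫ y, ψ y ∂ν ≤ ∫ p, c p.1 p.2 ∂π := by
  have := isProbabilityMeasure_of_mem_plans hπ
  rw [← integral_add_of_mem_plans hπ]
  exact integral_mono (integrable_of_continuous (by fun_prop) π)
    (integrable_of_continuous hc.continuous π) fun p => h p.1 p.2

variable [IsProbabilityMeasure ν]

theorem snd_withDensity_prod {g : X × X → ℝ} (hg : Continuous g) (hg0 : 0 ≤ g)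
    (h : ∀ᵐ y ∂ν, ∫ x, g (x, y) ∂μ = 1) :
    ((μ.prod ν).withDensity fun p => ENNReal.ofReal (g p)).snd = ν := by
  ext s hs
  rw [Measure.snd_apply hs, withDensity_apply _ (measurable_snd hs), ← Set.univ_prod,
    ← Measure.prod_restrict, lintegral_prod_symm' _ (by fun_prop), Measure.restrict_univ]
  have h1 : ∀ᵐ y ∂ν.restrict s, ∫⁻ x, ENNReal.ofReal (g (x, y)) ∂μ = 1 := by
    filter_upwards [ae_restrict_of_ae h] with y hy
    rw [← ofReal_integral_eq_lintegral_ofReal (integrable_of_continuous (by fun_prop) μ)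
      (Eventually.of_forall fun x => hg0 (x, y)), hy, ENNReal.ofReal_one]
  rw [lintegral_congr_ae h1]
  simp

theorem fst_withDensity_prod {g : X × X → ℝ} (hg : Continuous g) (hg0 : 0 ≤ g)
    (h : ∀ᵐ x ∂μ, ∫ y, g (x, y) ∂ν = 1) :
    ((μ.prod ν).withDensity fun p => ENNReal.ofReal (g p)).fst = μ := by
  ext s hs
  rw [Measure.fst_apply hs, withDensity_apply _ (measurable_fst hs), ← Set.prod_univ,
    ← Measure.prod_restrict, lintegral_prod _ (by fun_prop), Measure.restrict_univ]
  have h1 : ∀ᵐ x ∂μ.restrict s, ∫⁻ y, ENNReal.ofReal (g (x, y)) ∂ν = 1 := by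
    filter_upwards [ae_restrict_of_ae h] with x hx
    rw [← ofReal_integral_eq_lintegral_ofReal (integrable_of_continuous (by fun_prop) ν)
      (Eventually.of_forall fun y => hg0 (x, y)), hx, ENNReal.ofReal_one]
  rw [lintegral_congr_ae h1]
  simp

/-- The Gibbs density of optimal potentials defines a plan whose entropic cost is the dual
value. -/
theorem IsEntropicOptimal.exists_plan (hc : LipschitzWith L fun p : X × X => c p.1 p.2)
    (hs : ∀ x y, c x y = c y x) (hε : 0 < ε) {φ ψ : C(X, ℝ)}
    (h : IsEntropicOptimal c ε μ ν φ ψ) :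
    ∃ π ∈ plans μ ν, InformationTheory.klDiv π (μ.prod ν) ≠ ⊤ ∧
      ∫ p, c p.1 p.2 ∂π + ε * (InformationTheory.klDiv π (μ.prod ν)).toReal =
        ∫ x, φ x ∂μ + ∫ y, ψ y ∂ν := by
  have hcc := hc.continuous
  set g : X × X → ℝ := fun p => Real.exp ((φ p.1 + ψ p.2 - c p.1 p.2) / ε) with hg
  have hgc : Continuous g := continuous_density hc ε φ ψ
  have hg0 : 0 ≤ g := fun p => (Real.exp_pos _).le
  set π := (μ.prod ν).withDensity fun p => ENNReal.ofReal (g p) with hπdef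
  have hπ : π ∈ plans μ ν := by
    refine ⟨fst_withDensity_prod hgc hg0 ?_, snd_withDensity_prod hgc hg0 ?_⟩
    · filter_upwards [(h.swap hs).ae_eq_softTransform hc hε] with x hx
      have h1 := integral_density_left (μ := ν) hc hε ψ φ x
      rw [hx, sub_self, zero_div, Real.exp_zero, ← hx] at h1
      simp_rw [hs _ x, add_comm _ (φ x)] at h1
      exact h1
    · filter_upwards [h.ae_eq_softTransform hc hε] with y hy
      have h1 := integral_density_left (μ := μ) hc hε φ ψ y
      rw [hy, sub_self, zero_div, Real.exp_zero, ← hy] at h1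
      exact h1
  have hprob := isProbabilityMeasure_of_mem_plans hπ
  have hac : π ≪ μ.prod ν := withDensity_absolutelyContinuous _ _
  -- The log-density is `(φ + ψ - c) / ε`, so `ε` times the divergence cancels the transport cost
  -- and leaves the integral of `φ + ψ`.
  have hllr : llr π (μ.prod ν) =ᵐ[π] fun p => (φ p.1 + ψ p.2 - c p.1 p.2) / ε := by
    have h1 : π.rnDeriv (μ.prod ν) =ᵐ[μ.prod ν] fun p => ENNReal.ofReal (g p) :=
      Measure.rnDeriv_withDensity _ (by fun_prop)
    filter_upwards [hac.ae_le h1] with p hp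
    simp only [llr_def]
    rw [hp, ENNReal.toReal_ofReal (hg0 p), hg, Real.log_exp]
  have hint : Integrable (llr π (μ.prod ν)) π :=
    (integrable_congr hllr).2 (integrable_of_continuous (by fun_prop) π)
  refine ⟨π, hπ, InformationTheory.klDiv_ne_top hac hint, ?_⟩
  rw [InformationTheory.toReal_klDiv_of_measure_eq hac (by simp), integral_congr_ae hllr,
    integral_div, integral_sub (integrable_of_continuous (by fun_prop) π)
    (integrable_of_continuous hcc π), integral_add_of_mem_plans hπ]
  field_simp
  ring

end Plans

/-! ### Hard `c`-transforms and feasible extension. -/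

section CTransform

variable {X : Type*} [MetricSpace X] {c : X → X → ℝ} {L : NNReal}

/-- A minimum over a compact set of functions that are `L`-Lipschitz in `y` is `L`-Lipschitz.
Attainment is recorded because the extension argument uses the minimizers. -/
theorem exists_cTransform (hc : LipschitzWith L fun p : X × X => c p.1 p.2) {S : Set X}
    (hS : IsCompact S) (hne : S.Nonempty) (φ : C(X, ℝ)) :
    ∃ ψ : C(X, ℝ), ∀ y, (∀ x ∈ S, ψ y ≤ c x y - φ x) ∧ ∃ x ∈ S, ψ y = c x y - φ x := by
  choose x hxS hx using fun y =>
    hS.exists_isMinOn hne (continuous_cost_sub_left hc φ y).continuousOn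
  have hlip : LipschitzWith L fun y => c (x y) y - φ (x y) :=
    LipschitzWith.of_le_add_mul L fun y y' => by
      have h1 := hx y (hxS y')
      simp only [Set.mem_ofPred_eq] at h1
      linarith [le_of_abs_le (abs_cost_sub_le hc (x y') y y')]
  exact ⟨⟨_, hlip.continuous⟩, fun y => ⟨fun z hz => hx y hz, x y, hxS y, rfl⟩⟩

/-- Functions that are `c`-conjugate to each other on two compact sets extend to a feasible pair
of continuous functions. -/
theorem exists_isFeasible_extension (hc : LipschitzWith L fun p : X × X => c p.1 p.2)
    (hs : ∀ x y, c x y = c y x) [CompactSpace X] {S T : Set X} (hS : IsCompact S)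
    (hne : S.Nonempty) {φ ψ : C(X, ℝ)} (hle : ∀ x ∈ S, ∀ y ∈ T, φ x + ψ y ≤ c x y)
    (hφ : ∀ x ∈ S, ∃ y ∈ T, c x y ≤ φ x + ψ y) (hψ : ∀ y ∈ T, ∃ x ∈ S, c x y ≤ φ x + ψ y) :
    ∃ φ₁ ψ₁ : C(X, ℝ), Set.EqOn φ₁ φ S ∧ Set.EqOn ψ₁ ψ T ∧ IsFeasible c φ₁ ψ₁ := by
  -- The first transform is taken over `S` only, the second over all of `X`, which forces
  -- feasibility everywhere; conjugacy preserves the values on `T` and `S`.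
  obtain ⟨ψ₁, hψ₁⟩ := exists_cTransform hc hS hne φ
  obtain ⟨φ₁, hφ₁⟩ := exists_cTransform hc isCompact_univ (hne.mono (Set.subset_univ S)) ψ₁
  have hψeq : Set.EqOn ψ₁ ψ T := fun y hy => by
    obtain ⟨x, hx, hxy⟩ := (hψ₁ y).2
    obtain ⟨x', hx', hxy'⟩ := hψ y hy
    refine le_antisymm ?_ ?_
    · linarith [(hψ₁ y).1 x' hx']
    · linarith [hle x hx y hy]
  refine ⟨φ₁, ψ₁, fun x hx => le_antisymm ?_ ?_, hψeq, fun x y => ?_⟩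
  · obtain ⟨y, hy, hxy⟩ := hφ x hx
    have h1 := (hφ₁ x).1 y trivial
    rw [hψeq hy, hs] at h1
    linarith
  · obtain ⟨y, -, hxy⟩ := (hφ₁ x).2
    rw [hs] at hxy
    linarith [(hψ₁ y).1 x hx]
  · have h1 := (hφ₁ x).1 y trivial
    rw [hs] at h1
    linarith

end CTransform

/-! ### The limit `ε → 0`. -/

section SmallRegularization

variable {X : Type*} [MetricSpace X] [CompactSpace X] [MeasurableSpace X] [BorelSpace X]
  {c : X → X → ℝ} {L : NNReal} {μ ν : Measure X}
  [IsProbabilityMeasure μ] [IsProbabilityMeasure ν] {l : Filter ℝ} {φ ψ : ℝ → C(X, ℝ)}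
  {φ₀ ψ₀ : C(X, ℝ)}

theorem tendsto_integral_of_tendstoUniformlyOn_support
    (hφ : TendstoUniformlyOn (fun ε x => φ ε x) φ₀ l μ.support) :
    Tendsto (fun ε => ∫ x, φ ε x ∂μ) l (𝓝 (∫ x, φ₀ x ∂μ)) := by
  have hμ : ∀ᵐ x ∂μ, x ∈ μ.support := Measure.support_mem_ae
  refine Metric.tendsto_nhds.2 fun δ hδ => ?_
  filter_upwards [Metric.tendstoUniformlyOn_iff.1 hφ (δ / 2) (half_pos hδ)] with ε h
  refine lt_of_le_of_lt ?_ (half_lt_self hδ)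
  rw [Real.dist_eq]
  refine abs_integral_sub_integral_le (φ ε).continuous φ₀.continuous ?_
  filter_upwards [hμ] with x hx
  rw [← Real.dist_eq, dist_comm]
  exact (h x hx).le

/-- A violation at a point of the supports persists on a neighbourhood `U` of positive measure,
where the Gibbs density is at least `exp (δ / ε)`. Its integral in the first variable is `1`, so
Markov's inequality fails for small `ε`. -/
theorem add_le_cost_of_tendstoUniformlyOn [l.NeBot] (hl : l ≤ 𝓝[>] (0 : ℝ))
    (hc : LipschitzWith L fun p : X × X => c p.1 p.2)
    (h : ∀ ε : ℝ, 0 < ε → IsEntropicOptimal c ε μ ν (φ ε) (ψ ε))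
    (hφ : TendstoUniformlyOn (fun ε x => φ ε x) φ₀ l μ.support)
    (hψ : TendstoUniformlyOn (fun ε y => ψ ε y) ψ₀ l ν.support) {x y : X} (hx : x ∈ μ.support)
    (hy : y ∈ ν.support) : φ₀ x + ψ₀ y ≤ c x y := by
  have hμ : ∀ᵐ x ∂μ, x ∈ μ.support := Measure.support_mem_ae
  by_contra! hlt
  -- Of the gap `4δ`, one `δ` is lost on passing to `U` and two on replacing the limits by `φ ε` and
  -- `ψ ε`; one remains.
  obtain ⟨δ, hδ, hgap⟩ : ∃ δ > 0, c x y + 4 * δ = φ₀ x + ψ₀ y :=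
    ⟨(φ₀ x + ψ₀ y - c x y) / 4, by linarith, by ring⟩
  set U : Set X := {z | 3 * δ < φ₀ z + ψ₀ y - c z y} with hU
  have hcy : Continuous fun z => c z y :=
    hc.continuous.comp (by fun_prop : Continuous fun z : X => (z, y))
  have hUo : IsOpen U := isOpen_lt continuous_const (by fun_prop)
  have hUpos : 0 < μ.real U :=
    ENNReal.toReal_pos ((Measure.mem_support_iff_forall x).1 hx U (hUo.mem_nhds (by
      simp only [hU, Set.mem_ofPred_eq]; linarith))).ne' (measure_ne_top _ _)
  have hpos : ∀ᶠ ε in l, 0 < ε := hl self_mem_nhdsWithin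
  have hsmall : ∀ᶠ ε in l, ε < δ * μ.real U :=
    hl (nhdsWithin_le_nhds (Iio_mem_nhds (mul_pos hδ hUpos)))
  obtain ⟨ε, hε, hεU, hφε, hψε⟩ := (hpos.and (hsmall.and
    ((Metric.tendstoUniformlyOn_iff.1 hφ δ hδ).and
      (Metric.tendstoUniformlyOn_iff.1 hψ δ hδ)))).exists
  have hone : ∫ z, Real.exp ((φ ε z + ψ ε y - c z y) / ε) ∂μ = 1 := by
    rw [integral_density_left hc hε, softTransform_apply, ← (h ε hε).eq_softMin_right hc hε hy]
    simp
  have hmarkov := mul_meas_ge_le_integral_of_nonneg (μ := μ)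
    (f := fun z => Real.exp ((φ ε z + ψ ε y - c z y) / ε))
    (Eventually.of_forall fun z => (Real.exp_pos _).le)
    (integrable_of_continuous (by fun_prop) μ) (Real.exp (δ / ε))
  rw [hone] at hmarkov
  have hsub : μ.real U ≤
      μ.real {z | Real.exp (δ / ε) ≤ Real.exp ((φ ε z + ψ ε y - c z y) / ε)} := by
    refine ENNReal.toReal_mono (measure_ne_top _ _) (measure_mono_ae ?_)
    filter_upwards [hμ] with z hz hzU
    have h1 := hφε z hz
    have h2 := hψε y hy
    rw [Real.dist_eq, abs_sub_lt_iff] at h1 h2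
    have h3 : 3 * δ < φ₀ z + ψ₀ y - c z y := hzU
    change Real.exp (δ / ε) ≤ Real.exp ((φ ε z + ψ ε y - c z y) / ε)
    rw [Real.exp_le_exp]
    gcongr
    linarith
  have h1 : δ / ε * μ.real U ≤ 1 := by
    refine le_trans ?_ hmarkov
    have := Real.add_one_le_exp (δ / ε)
    gcongr
    linarith
  rw [div_mul_eq_mul_div, div_le_one hε] at h1
  linarith

/-- A soft minimum is at least the minimum over the support; the witness is a minimizer for the
limit potential. -/
theorem exists_cost_le_add_of_tendstoUniformlyOn [l.NeBot] (hl : l ≤ 𝓝[>] (0 : ℝ))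
    (hc : LipschitzWith L fun p : X × X => c p.1 p.2)
    (h : ∀ ε : ℝ, 0 < ε → IsEntropicOptimal c ε μ ν (φ ε) (ψ ε))
    (hφ : TendstoUniformlyOn (fun ε x => φ ε x) φ₀ l μ.support)
    (hψ : TendstoUniformlyOn (fun ε y => ψ ε y) ψ₀ l ν.support) {y : X} (hy : y ∈ ν.support) :
    ∃ x ∈ μ.support, c x y ≤ φ₀ x + ψ₀ y := by
  have hμ : ∀ᵐ x ∂μ, x ∈ μ.support := Measure.support_mem_ae
  obtain ⟨x, hx, hmin⟩ := μ.isClosed_support.isCompact.exists_isMinOn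
    (Measure.nonempty_support (IsProbabilityMeasure.ne_zero μ))
    (continuous_cost_sub_left hc φ₀ y).continuousOn
  refine ⟨x, hx, ?_⟩
  suffices hsuff : c x y - φ₀ x ≤ ψ₀ y by linarith
  refine le_of_forall_pos_le_add fun δ hδ => ?_
  have hpos : ∀ᶠ ε in l, 0 < ε := hl self_mem_nhdsWithin
  obtain ⟨ε, hε, hφε, hψε⟩ := (hpos.and
    ((Metric.tendstoUniformlyOn_iff.1 hφ (δ / 2) (half_pos hδ)).and
      (Metric.tendstoUniformlyOn_iff.1 hψ (δ / 2) (half_pos hδ)))).exists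
  have h1 : c x y - φ₀ x - δ / 2 ≤ ψ ε y := by
    rw [(h ε hε).eq_softMin_right hc hε hy]
    refine le_softMin_of_ae_le hε (continuous_cost_sub_left hc (φ ε) y) ?_
    filter_upwards [hμ] with z hz
    have h2 := hφε z hz
    rw [Real.dist_eq, abs_sub_lt_iff] at h2
    have h3 : c x y - φ₀ x ≤ c z y - φ₀ z := hmin hz
    linarith
  have h2 := hψε y hy
  rw [Real.dist_eq, abs_sub_lt_iff] at h2
  linarith

theorem exists_isKantorovichOptimal_of_tendstoUniformlyOn [l.NeBot] (hl : l ≤ 𝓝[>] (0 : ℝ))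
    (hc0 : ∀ x y, 0 ≤ c x y) (hs : ∀ x y, c x y = c y x)
    (hc : LipschitzWith L fun p : X × X => c p.1 p.2)
    (h : ∀ ε : ℝ, 0 < ε → IsEntropicOptimal c ε μ ν (φ ε) (ψ ε))
    (hφ : TendstoUniformlyOn (fun ε x => φ ε x) φ₀ l μ.support)
    (hψ : TendstoUniformlyOn (fun ε y => ψ ε y) ψ₀ l ν.support) :
    ∃ φ₁ ψ₁ : C(X, ℝ), Set.EqOn φ₁ φ₀ μ.support ∧ Set.EqOn ψ₁ ψ₀ ν.support ∧
      IsKantorovichOptimal c μ ν φ₁ ψ₁ ∧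
      ∫ x, φ₁ x ∂μ + ∫ y, ψ₁ y ∂ν = OT c μ ν ∧
      Tendsto (fun ε => ∫ x, φ ε x ∂μ) l (𝓝 (∫ x, φ₁ x ∂μ)) ∧
      Tendsto (fun ε => ∫ x, φ ε x ∂μ + ∫ y, ψ ε y ∂ν) l (𝓝 (OT c μ ν)) := by
  obtain ⟨φ₁, ψ₁, hφ₁, hψ₁, hfeas⟩ := exists_isFeasible_extension hc hs
    μ.isClosed_support.isCompact
    (Measure.nonempty_support (IsProbabilityMeasure.ne_zero μ))
    (fun x hx y hy => add_le_cost_of_tendstoUniformlyOn hl hc h hφ hψ hx hy)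
    (fun x hx => by
      obtain ⟨y, hy, hxy⟩ := exists_cost_le_add_of_tendstoUniformlyOn hl hc
        (fun ε hε => (h ε hε).swap hs) hψ hφ hx
      exact ⟨y, hy, by rw [hs]; linarith⟩)
    (fun y hy => exists_cost_le_add_of_tendstoUniformlyOn hl hc h hφ hψ hy)
  have hpos : ∀ᶠ ε in l, 0 < ε := hl self_mem_nhdsWithin
  have hlimφ : Tendsto (fun ε => ∫ x, φ ε x ∂μ) l (𝓝 (∫ x, φ₁ x ∂μ)) :=
    tendsto_integral_of_tendstoUniformlyOn_support (hφ.congr_right hφ₁.symm)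
  have hlimψ : Tendsto (fun ε => ∫ y, ψ ε y ∂ν) l (𝓝 (∫ y, ψ₁ y ∂ν)) :=
    tendsto_integral_of_tendstoUniformlyOn_support (hψ.congr_right hψ₁.symm)
  have hlim := hlimφ.add hlimψ
  -- Upper bound by weak duality; lower bound because each entropic dual value is the cost of an
  -- admissible plan, so at least `OTEps`, hence at least `OT`.
  have hOT : ∫ x, φ₁ x ∂μ + ∫ y, ψ₁ y ∂ν = OT c μ ν := by
    refine le_antisymm (le_OT fun π hπ => hfeas.integral_le hc hπ)
      (ge_of_tendsto hlim ?_)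
    filter_upwards [hpos] with ε hε
    obtain ⟨π, hπ, hkl, hval⟩ := (h ε hε).exists_plan hc hs hε
    rw [← hval]
    exact (OT_le_OTEps hc0 hε).trans (OTEps_le hc0 hε hπ hkl)
  refine ⟨φ₁, ψ₁, hφ₁, hψ₁, ⟨hfeas, fun φ' ψ' hfeas' => ?_⟩, hOT, hlimφ, hOT ▸ hlim⟩
  rw [hOT]
  exact le_OT fun π hπ => hfeas'.integral_le hc hπ

theorem exists_extension_of_mapClusterPt (hc0 : ∀ x y, 0 ≤ c x y) (hs : ∀ x y, c x y = c y x)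
    (hc : LipschitzWith L fun p : X × X => c p.1 p.2)
    (h : ∀ ε : ℝ, 0 < ε → IsEntropicOptimal c ε μ ν (φ ε) (ψ ε) ∧ IsNormalized c μ ν (φ ε))
    {φ₀ : C(μ.support, ℝ)} {ψ₀ : C(ν.support, ℝ)}
    (hclus : MapClusterPt (φ₀, ψ₀) (𝓝[>] (0 : ℝ))
      fun ε => ((φ ε).restrict μ.support, (ψ ε).restrict ν.support)) :
    ∃ φ₁ ψ₁ : C(X, ℝ), φ₁.restrict μ.support = φ₀ ∧ ψ₁.restrict ν.support = ψ₀ ∧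
      IsKantorovichOptimal c μ ν φ₁ ψ₁ ∧
      ∫ x, φ₁ x ∂μ + ∫ y, ψ₁ y ∂ν = OT c μ ν ∧ IsNormalized c μ ν φ₁ := by
  have : CompactSpace μ.support := isCompact_iff_compactSpace.1 μ.isClosed_support.isCompact
  have : CompactSpace ν.support := isCompact_iff_compactSpace.1 ν.isClosed_support.isCompact
  -- Tietze extension; the values off the support play no role.
  obtain ⟨φ₀, rfl⟩ := ContinuousMap.exists_restrict_eq μ.isClosed_support φ₀
  obtain ⟨ψ₀, rfl⟩ := ContinuousMap.exists_restrict_eq ν.isClosed_support ψ₀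
  obtain ⟨U, hU, hlim⟩ := mapClusterPt_iff_ultrafilter.1 hclus
  rw [nhds_prod_eq] at hlim
  have hφ : TendstoUniformlyOn (fun ε x => φ ε x) φ₀ U μ.support :=
    tendstoUniformlyOn_iff_tendstoUniformly_comp_coe.2
      (ContinuousMap.tendsto_iff_tendstoUniformly.1 hlim.fst)
  have hψ : TendstoUniformlyOn (fun ε y => ψ ε y) ψ₀ U ν.support :=
    tendstoUniformlyOn_iff_tendstoUniformly_comp_coe.2
      (ContinuousMap.tendsto_iff_tendstoUniformly.1 hlim.snd)
  obtain ⟨φ₁, ψ₁, hφ₁, hψ₁, hopt, hOT, hint, -⟩ :=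
    exists_isKantorovichOptimal_of_tendstoUniformlyOn hU hc0 hs hc (fun ε hε => (h ε hε).1) hφ hψ
  refine ⟨φ₁, ψ₁, ContinuousMap.ext fun x => hφ₁ x.2, ContinuousMap.ext fun y => hψ₁ y.2, hopt,
    hOT, tendsto_nhds_unique hint (tendsto_const_nhds.congr' ?_)⟩
  have hpos : ∀ᶠ ε in (U : Filter ℝ), 0 < ε := hU self_mem_nhdsWithin
  filter_upwards [hpos] with ε hε
  exact (h ε hε).2.symm

/-- Along any ultrafilter the uniformly bounded Lipschitz potentials converge, and `OTEps` is
squeezed between `OT` and the dual values, which tend to `OT`. -/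
theorem tendsto_OTEps (hc0 : ∀ x y, 0 ≤ c x y) (hs : ∀ x y, c x y = c y x)
    (hc : LipschitzWith L fun p : X × X => c p.1 p.2) :
    Tendsto (fun ε : ℝ => OTEps c ε μ ν) (𝓝[>] (0 : ℝ)) (𝓝 (OT c μ ν)) := by
  obtain ⟨R, hR⟩ := exists_isEntropicOptimal hc hs μ ν
  choose! φ ψ hopt _ hφ hψ using hR
  rw [tendsto_iff_ultrafilter]
  intro U hU
  have hpos : ∀ᶠ ε in (U : Filter ℝ), 0 < ε := hU self_mem_nhdsWithin
  obtain ⟨φ₀, -, hφ₀⟩ := (isCompact_setOf_lipschitzWith_mem_Icc L (-R) R).ultrafilter_le_nhds'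
    (U.map φ) (hpos.mono hφ)
  obtain ⟨ψ₀, -, hψ₀⟩ := (isCompact_setOf_lipschitzWith_mem_Icc L (-R) R).ultrafilter_le_nhds'
    (U.map ψ) (hpos.mono hψ)
  obtain ⟨-, -, -, -, -, -, -, hlim⟩ :=
    exists_isKantorovichOptimal_of_tendstoUniformlyOn hU hc0 hs hc hopt
      (ContinuousMap.tendsto_iff_tendstoUniformly.1 hφ₀).tendstoUniformlyOn
      (ContinuousMap.tendsto_iff_tendstoUniformly.1 hψ₀).tendstoUniformlyOn
  refine tendsto_of_tendsto_of_tendsto_of_le_of_le' tendsto_const_nhds hlim ?_ ?_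
  · filter_upwards [hpos] with ε hε using OT_le_OTEps hc0 hε
  · filter_upwards [hpos] with ε hε
    obtain ⟨π, hπ, hkl, hval⟩ := (hopt ε hε).exists_plan hc hs hε
    rw [← hval]
    exact OTEps_le hc0 hε hπ hkl

end SmallRegularization

end EntropicOT

theorem mainTheorem1 {X : Type*} [MetricSpace X] [CompactSpace X] [MeasurableSpace X]
    [BorelSpace X] (c : X → X → ℝ) (hc_nonneg : ∀ x y, 0 ≤ c x y)
    (hc_symm : ∀ x y, c x y = c y x)
    (hc_lip : ∃ L : NNReal, LipschitzWith L (fun p : X × X => c p.1 p.2))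
    (μ ν : Measure X) [IsProbabilityMeasure μ] [IsProbabilityMeasure ν] :
    -- normalized optimal potentials exist, and their restrictions to the supports are unique
    (∀ ε : ℝ, 0 < ε →
      (∃ φ ψ : C(X, ℝ), EntropicOT.IsEntropicOptimal c ε μ ν φ ψ ∧
        EntropicOT.IsNormalized c μ ν φ) ∧
      (∀ φ ψ φ' ψ' : C(X, ℝ),
        EntropicOT.IsEntropicOptimal c ε μ ν φ ψ → EntropicOT.IsNormalized c μ ν φ →
        EntropicOT.IsEntropicOptimal c ε μ ν φ' ψ' → EntropicOT.IsNormalized c μ ν φ' →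
        Set.EqOn φ φ' μ.support ∧ Set.EqOn ψ ψ' ν.support)) ∧
    (∀ φ ψ : ℝ → C(X, ℝ),
      (∀ ε : ℝ, 0 < ε → EntropicOT.IsEntropicOptimal c ε μ ν (φ ε) (ψ ε) ∧
        EntropicOT.IsNormalized c μ ν (φ ε)) →
      -- uniform convergence on the supports as `ε → ∞`
      (TendstoUniformlyOn (fun ε x => φ ε x)
          (fun x => ∫ y, c x y ∂ν - 1 / 2 * EntropicOT.OTInf c μ ν) atTop μ.support ∧
        TendstoUniformlyOn (fun ε y => ψ ε y)
          (fun y => ∫ x, c x y ∂μ - 1 / 2 * EntropicOT.OTInf c μ ν) atTop ν.support) ∧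
      -- accumulation points of the restricted potentials as `ε → 0`
      (∀ (φ₀ : C(μ.support, ℝ)) (ψ₀ : C(ν.support, ℝ)),
        MapClusterPt (φ₀, ψ₀) (𝓝[>] (0 : ℝ))
          (fun ε => ((φ ε).restrict μ.support, (ψ ε).restrict ν.support)) →
        ∃ φ₁ ψ₁ : C(X, ℝ), φ₁.restrict μ.support = φ₀ ∧ ψ₁.restrict ν.support = ψ₀ ∧
          EntropicOT.IsKantorovichOptimal c μ ν φ₁ ψ₁ ∧
          ∫ x, φ₁ x ∂μ + ∫ y, ψ₁ y ∂ν = EntropicOT.OT c μ ν ∧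
          EntropicOT.IsNormalized c μ ν φ₁)) ∧
    Tendsto (fun ε : ℝ => EntropicOT.OTEps c ε μ ν) (𝓝[>] (0 : ℝ))
      (𝓝 (EntropicOT.OT c μ ν)) := by
  obtain ⟨L, hc⟩ := hc_lip
  refine ⟨fun ε hε => ⟨?_, fun φ ψ φ' ψ' h hn h' hn' =>
    h.eqOn_support hc hε h' (hn.trans hn'.symm)⟩, fun φ ψ h =>
    ⟨EntropicOT.tendstoUniformlyOn_atTop hc hc_symm h, fun φ₀ ψ₀ hclus =>
      EntropicOT.exists_extension_of_mapClusterPt hc_nonneg hc_symm hc h hclus⟩,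
    EntropicOT.tendsto_OTEps hc_nonneg hc_symm hc⟩
  obtain ⟨R, hR⟩ := EntropicOT.exists_isEntropicOptimal hc hc_symm μ ν
  obtain ⟨φ, ψ, hopt, hnorm, -⟩ := hR ε hε
  exact ⟨φ, ψ, hopt, hnorm⟩
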